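/- **Setting.** Consider the quadratic program $\min_x \tfrac12 x^THx+c^Tx$ subject to $Ax\ge b$, with $H\in\mathbb R^{n\times n}$, $A\in\mathbb R^{m\times n}$, $c\in\mathbb R^n$, $b\in\mathbb R^m$. Write $z=(x,\lambda,s)\in\mathbb R^{n+2m}$, $\Lambda=\mathrm{diag}(\lambda)$, $S=\mathrm{diag}(s)$, $e=(1,\dots,1)^T$, and $$F_\mu(z)=\begin{pmatrix}Hx+c-A^T\lambda\\ Ax-s-b\\ \Lambda Se-\mu e\end{pmatrix},\qquad F'(z)=\begin{pmatrix}H&-A^T&0\\A&0&-I\\0&S&\Lambda\end{pmatrix}.$$ All norms are 2-norms and $\mathcal B(z^*,\delta)=\{z:\|z-z^*\|<\delta\}$. Let $z^*=(x^*,\lambda^*,s^*)$ satisfy the second-order sufficient conditions and strict complementarity: $Hx^*+c-A^T\lambda^*=0$, $Ax^*-s^*-b=0$, $s^*\ge0$, $\lambda^*\ge0$, $s_i^*\lambda_i^*=0$ for all $i$; $p^THp>0$ for every $p\ne0$ with $(Ap)_i=0$ for all $i$ with $s_i^*=0<\lambda_i^*$; and $s_i^*+\lambda_i^*>0$ for all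 $i$. Let $\delta,M>0$ be such that $F'(z)$ is nonsingular with $\|F'(z)^{-1}\|\le M$ for all $z\in\mathcal B(z^*,\delta)$, and put $C_3=\sup_{z\in\mathcal B(z^*,\delta)}\|F'(z)^{-1}\,\partial F_\mu(z)/\partial\mu\|$, where $\partial F_\mu/\partial\mu=(0,0,-e)$. Let $\hat\mu>0$ be such that there is a Lipschitz continuous barrier trajectory $\mu\mapsto z^\mu\in\mathcal B(z^*,\delta)$ with $F_\mu(z^\mu)=0$ for $0<\mu\le\hat\mu$. For $C>0$, $0\le r<m$, $0<\mu\le\hat\mu$, $0<\sigma<1$, $0<\sigma^+\le1$, let $z\in\mathcal B(z^*,\delta)$ satisfy $\|F_\mu(z)\|\le C\mu$. Let $\Delta\hat z=(\Delta\hat x,\Delta\hat\lambda,\Delta\hat s)$ solve $F'(z)\Delta\hat z=-F_{\mu^+}(z)$ with $\mu^+=\sigma\mu$, put $z^+=z+\Delta\hat z$, and suppose $z^+\in\mathcal B(z^*,\delta)$. Put $q_i=\sqrt{(\Delta\hat\lambda_i)^2+(\Delta\hat s_i)^2}$, let $q_{(1)}\ge\dots\ge q_{(m)}$ be these numbers in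 descending order, and let $\mathcal U_r$ be a set of indices of $r$ largest of the $q_i$ (ties broken in any way). With $$U_*=\sum_{i\in\mathcal U_r}e_{n+m+i}\big(\Delta\hat s_i\,e_{n+i}+\Delta\hat\lambda_i\,e_{n+m+i}\big)^T,\qquad B^+=F'(z)+U_*,\qquad \mu^{++}=\sigma^+\mu^+,$$ let $\Delta\hat z^+$ and $\Delta z^+$ be the Newton and modified Newton steps, $F'(z^+)\Delta\hat z^+=-F_{\mu^{++}}(z^+)$ and $B^+\Delta z^+=-F_{\mu^{++}}(z^+)$. **Theorem.** If the rows $A_i$ with $s_i^*=0$ are linearly independent, then such $\delta,M$ exist. For every such $\delta,M$ such $\hat\mu$ and $z^\mu$ exist, and for every such $\delta,M,\hat\mu,z^\mu$, every $0\le r<m$ and every $C>0$: 1. There is a constant $C^{(r+1)}>0$ such that $q_{(r+1)}\le C^{(r+1)}\mu$ for all $\mu,\sigma,z$ as above. 2. There is $K>0$ such that for every $C^{(r+1)}>0$ there is $0<\bar\mu\le\hat\mu$ such that, for all $0<\mu\le\bar\mu$ and all $\sigma,\sigma^+,z,\mathcal U_r$ as above with $q_{(r+1)}\le C^{(r+1)}\mu$,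 we have $MC^{(r+1)}\mu<1$, $B^+$ is nonsingular, and $$\|\Delta\hat z^+-\Delta z^+\|\le\frac{MC^{(r+1)}}{1-MC^{(r+1)}\mu}\Big(C_3(1-\sigma^+)\sigma\mu^2+K\mu^3\Big).$$ 3. There are $K'>0$ and $0<\bar\mu\le\hat\mu$ such that, for all $0<\mu\le\bar\mu$ and all $\sigma,\sigma^+,z,\mathcal U_r$ as above, $\|\Delta\hat z^+-\Delta z^+\|\le K'\mu^2$, and $\|\Delta\hat z^+-\Delta z^+\|\le K'\mu^3$ if $\sigma^+=1$. -/

import Mathlib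

open scoped Matrix Matrix.Norms.L2Operator

noncomputable section

namespace QPBarrier

/-- Index set of a primal-dual vector `z = (x, lam, s)` in `ℝ^(n+2m)`:
the blocks are `x`, `lam` and `s`, in this order. -/
abbrev Idx (n m : ℕ) : Type := Fin n ⊕ (Fin m ⊕ Fin m)

/-- The space `ℝ^(n+2m)` of triples `(x, lam, s)`, with the Euclidean norm. -/
abbrev PDVec (n m : ℕ) : Type := EuclideanSpace ℝ (Idx n m)

/-- The coordinate of index `j` of the `x`-block. -/
abbrev ix {n m : ℕ} (j : Fin n) : Idx n m := Sum.inl j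
/-- The coordinate of index `i` of the `lam`-block. -/
abbrev il {n m : ℕ} (i : Fin m) : Idx n m := Sum.inr (Sum.inl i)
/-- The coordinate of index `i` of the `s`-block. -/
abbrev is {n m : ℕ} (i : Fin m) : Idx n m := Sum.inr (Sum.inr i)

/-- The primal part `x` of `z = (x, lam, s)`. -/
def primal {n m : ℕ} (z : PDVec n m) : Fin n → ℝ := fun j => z (ix j)
/-- The multipliers `lam` of `z = (x, lam, s)`. -/
def mult {n m : ℕ} (z : PDVec n m) : Fin m → ℝ := fun i => z (il i)
/-- The slack variables `s` of `z = (x, lam, s)`. -/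
def slack {n m : ℕ} (z : PDVec n m) : Fin m → ℝ := fun i => z (is i)

/-- Data of the quadratic program: minimize `½ xᵀ H x + cᵀ x` subject to `A x ≥ b`. -/
structure QP (n m : ℕ) where
  H : Matrix (Fin n) (Fin n) ℝ
  c : Fin n → ℝ
  A : Matrix (Fin m) (Fin n) ℝ
  b : Fin m → ℝ

variable {n m : ℕ}

/-- The map `F_μ(z) = (H x + c - Aᵀ lam, A x - s - b, Λ S e - μ e)`. -/
def QP.residual (P : QP n m) (μ : ℝ) (z : PDVec n m) : PDVec n m :=
  WithLp.toLp 2 (Sum.elim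
    (P.H *ᵥ primal z + P.c - P.Aᵀ *ᵥ mult z)
    (Sum.elim (P.A *ᵥ primal z - slack z - P.b) (fun i => mult z i * slack z i - μ)))

/-- The Jacobian `F'(z) = [[H, -Aᵀ, 0], [A, 0, -I], [0, S, Λ]]`. -/
def QP.jac (P : QP n m) (z : PDVec n m) : Matrix (Idx n m) (Idx n m) ℝ :=
  Matrix.fromBlocks
    P.H (Matrix.fromCols (-P.Aᵀ) 0)
    (Matrix.fromRows P.A 0)
    (Matrix.fromBlocks 0 (-1) (Matrix.diagonal (slack z)) (Matrix.diagonal (mult z)))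

/-- The partial derivative `∂F_μ(z)/∂μ = (0, 0, -e)`, which depends neither on `μ` nor on `z`. -/
def residualDeriv (n m : ℕ) : PDVec n m :=
  WithLp.toLp 2 (Sum.elim 0 (Sum.elim 0 (fun _ => -1)))

theorem QP.hasDerivAt_residual (P : QP n m) (z : PDVec n m) (μ : ℝ) :
    HasDerivAt (fun ν => P.residual ν z) (residualDeriv n m) μ := by
  have h : (fun ν : ℝ => P.residual ν z) =
      fun ν : ℝ => P.residual 0 z + ν • residualDeriv n m := by
    funext ν
    ext k
    rcases k with j | i | i <;> simp [QP.residual, residualDeriv, sub_eq_add_neg]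
  rw [h]
  simpa using ((hasDerivAt_id μ).smul_const (residualDeriv n m)).const_add (P.residual 0 z)

/-- `z = (x, lam, s)` satisfies the second-order sufficient optimality conditions and strict
complementarity.  The curvature condition says that `H` is positive definite on the null space of
the rows of `A` that belong to the active constraints with strictly positive multiplier. -/
structure QP.IsStrictMin (P : QP n m) (z : PDVec n m) : Prop where
  stationarity : P.H *ᵥ primal z + P.c - P.Aᵀ *ᵥ mult z = 0
  feasibility : P.A *ᵥ primal z - slack z - P.b = 0
  slack_nonneg : ∀ i, 0 ≤ slack z i
  mult_nonneg : ∀ i, 0 ≤ mult z i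
  complementarity : ∀ i, slack z i * mult z i = 0
  posDef : ∀ p : Fin n → ℝ, p ≠ 0 →
    (∀ i, slack z i = 0 → 0 < mult z i → (P.A *ᵥ p) i = 0) → 0 < p ⬝ᵥ (P.H *ᵥ p)
  strict : ∀ i, 0 < slack z i + mult z i

/-- The rows of `A` that belong to the constraints active at `z` are linearly independent. -/
def QP.LICQ (P : QP n m) (z : PDVec n m) : Prop :=
  LinearIndependent ℝ (fun i : {i : Fin m // slack z i = 0} => P.A (i : Fin m))

/-- On the open ball of radius `δ` around `zs` the Jacobian is nonsingular and the spectral norm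
of its inverse is at most `M`. -/
def QP.IsJacNhd (P : QP n m) (zs : PDVec n m) (δ M : ℝ) : Prop :=
  0 < δ ∧ 0 < M ∧ ∀ z ∈ Metric.ball zs δ, IsUnit (P.jac z) ∧ ‖(P.jac z)⁻¹‖ ≤ M

/-- The constant `C₃`: the supremum over the ball of `‖F'(z)⁻¹ ∂F_μ(z)/∂μ‖`. -/
def QP.trajConst (P : QP n m) (zs : PDVec n m) (δ : ℝ) : ℝ :=
  ⨆ z : Metric.ball zs δ,
    ‖WithLp.toLp 2 ((P.jac (z : PDVec n m))⁻¹ *ᵥ (residualDeriv n m).ofLp)‖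

/-- `μ ↦ zμ μ` is a Lipschitz continuous barrier trajectory in the ball, for `0 < μ ≤ μhat`. -/
def QP.IsTrajectory (P : QP n m) (zs : PDVec n m) (δ μhat : ℝ) (zμ : ℝ → PDVec n m) : Prop :=
  0 < μhat ∧ (∃ L, LipschitzOnWith L zμ (Set.Ioc 0 μhat)) ∧
    ∀ μ ∈ Set.Ioc 0 μhat, zμ μ ∈ Metric.ball zs δ ∧ P.residual μ (zμ μ) = 0

/-- The quantities `sqrt (Δlam_i ^ 2 + Δs_i ^ 2)`. -/
def pairSize (dz : PDVec n m) (i : Fin m) : ℝ := √(mult dz i ^ 2 + slack dz i ^ 2)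

/-- The entry with (zero-based) position `k` of the list of the quantities `pairSize dz i`
arranged in descending order; position `r` holds the `(r+1)`-st largest of them. -/
def orderedPairSize (dz : PDVec n m) (k : Fin m) : ℝ :=
  pairSize dz (Tuple.sort (fun i => -pairSize dz i) k)

/-- `T` is a set of indices of the `r` largest of the quantities `pairSize dz i`
(ties are broken in any way). -/
def IsLargestSet (dz : PDVec n m) (r : ℕ) (T : Finset (Fin m)) : Prop :=
  T.card = r ∧ ∀ i ∈ T, ∀ j ∉ T, pairSize dz j ≤ pairSize dz i

/-- The update matrix `U_* = ∑_{i ∈ T} e_{n+m+i} (Δs_i e_{n+i} + Δlam_i e_{n+m+i})ᵀ`. -/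
def updateMatrix (dz : PDVec n m) (T : Finset (Fin m)) : Matrix (Idx n m) (Idx n m) ℝ :=
  ∑ i ∈ T, Matrix.vecMulVec (Pi.single (is i) 1)
    (slack dz i • Pi.single (il i) 1 + mult dz i • Pi.single (is i) 1)

/-- `dz` solves the Newton equation `F'(z) dz = -F_μ(z)`. -/
def QP.IsNewtonStep (P : QP n m) (μ : ℝ) (z dz : PDVec n m) : Prop :=
  P.jac z *ᵥ dz.ofLp = -(P.residual μ z).ofLp

/-- The first iteration: `z` is in the ball with `‖F_μ(z)‖ ≤ C μ`, `dz` is the Newton step at `z`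
for the barrier parameter `σ μ`, `z + dz` is in the ball, and `T` is the index set that defines
the rank-`r` update. -/
structure QP.IsFirstStep (P : QP n m) (zs : PDVec n m) (δ C : ℝ) (r : ℕ) (μ σ : ℝ)
    (z dz : PDVec n m) (T : Finset (Fin m)) : Prop where
  mem_ball : z ∈ Metric.ball zs δ
  residual_le : ‖P.residual μ z‖ ≤ C * μ
  newton : P.IsNewtonStep (σ * μ) z dz
  next_mem_ball : z + dz ∈ Metric.ball zs δ
  largest : IsLargestSet dz r T

/-- The modified Jacobian `B⁺ = F'(z) + U_*`. -/
def QP.modJac (P : QP n m) (z dz : PDVec n m) (T : Finset (Fin m)) :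
    Matrix (Idx n m) (Idx n m) ℝ :=
  P.jac z + updateMatrix dz T

/-- `dzm` solves the modified Newton equation `B⁺ dzm = -F_μ(z + dz)` at `z + dz`. -/
def QP.IsModNewtonStep (P : QP n m) (μ : ℝ) (z dz : PDVec n m) (T : Finset (Fin m))
    (dzm : PDVec n m) : Prop :=
  P.modJac z dz T *ᵥ dzm.ofLp = -(P.residual μ (z + dz)).ofLp

end QPBarrier

end

/-!
The map `F_μ` is quadratic: its second derivative in a direction `d` is the matrix with rows
`[0, diag Δs, diag Δλ]` in the complementarity block and zeros elsewhere, and its norm is the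
largest of the numbers `√(Δλ_i² + Δs_i²)`. Hence `F'(z⁺)` differs from `B⁺` only in the
complementarity rows outside `𝒰_r`, by at most `q_(r+1)` in norm, and the two steps at `z⁺` solve
linear systems with the same right-hand side, so they differ by at most
`M q_(r+1) / (1 - M q_(r+1))` times the norm of the Newton step. That norm is controlled by writing
`F_{μ⁺⁺}(z⁺)` as `F_{μ⁺}(z⁺)`, which is quadratic in the first Newton step, plus a multiple
`μ⁺⁺ - μ⁺` of `∂F_μ/∂μ`. The barrier trajectory is the local inverse of `F_0` at `z*`, composed with
the line `μ ↦ -μ ∂F_μ/∂μ`.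
-/

namespace QPBarrier

open Filter
open scoped Topology

theorem exists_mem_Ioc_forall_mem_Ioc {α : Type*} [TopologicalSpace α] [LinearOrder α]
    [OrderTopology α] [NoMaxOrder α] [DenselyOrdered α] {a b : α} {p : α → Prop} (hab : a < b)
    (h : ∀ᶠ x in 𝓝[>] a, p x) : ∃ u ∈ Set.Ioc a b, ∀ x ∈ Set.Ioc a u, p x := by
  obtain ⟨u, hu, hsub⟩ := mem_nhdsGT_iff_exists_Ioc_subset.1 h
  exact ⟨min b u, ⟨lt_min hab hu, min_le_left b u⟩, fun x hx =>
    hsub ⟨hx.1, hx.2.trans (min_le_right b u)⟩⟩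

theorem eventually_nhdsGT_zero_mul_lt (a : ℝ) {b : ℝ} (hb : 0 < b) :
    ∀ᶠ x in 𝓝[>] 0, a * x < b :=
  ((continuous_const_mul a).tendsto' 0 0 (mul_zero a)).eventually_lt_const hb
    |>.filter_mono nhdsWithin_le_nhds

theorem apply_sort_card_le_of_notMem {α : Type*} [LinearOrder α] {m : ℕ} {f : Fin m → α}
    {T : Finset (Fin m)} (hT : ∀ i ∈ T, ∀ j ∉ T, f i ≤ f j) (hr : T.card < m) {j : Fin m}
    (hj : j ∉ T) : f (Tuple.sort f ⟨T.card, hr⟩) ≤ f j := by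
  have hmono : Monotone (f ∘ Tuple.sort f) := Tuple.monotone_sort f
  refine (Tuple.lt_card_le_iff_apply_le_of_monotone hmono).1 ?_
  have hsub : (insert j T).map (Tuple.sort f).symm.toEmbedding ⊆
      Finset.univ.filter fun k => (f ∘ Tuple.sort f) k ≤ f j := by
    intro k hk
    obtain ⟨i, hi, rfl⟩ := Finset.mem_map.1 hk
    rcases Finset.mem_insert.1 hi with rfl | hi
    · simp
    · simpa using hT i hi j hj
  simpa [hj] using Finset.card_le_card hsub

theorem exists_lipschitzOnWith_rightInverse {𝕜 E F : Type*} [NontriviallyNormedField 𝕜]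
    [NormedAddCommGroup E] [NormedSpace 𝕜 E] [CompleteSpace E] [NormedAddCommGroup F]
    [NormedSpace 𝕜 F] {f : E → F} {f' : E ≃L[𝕜] F} {a : E}
    (hf : HasStrictFDerivAt f (f' : E →L[𝕜] F) a) {U : Set E} (hU : U ∈ 𝓝 a) :
    ∃ V ∈ 𝓝 (f a), ∃ g : F → E, (∃ L, LipschitzOnWith L g V) ∧ ∀ y ∈ V, g y ∈ U ∧ f (g y) = y := by
  obtain ⟨L, V, hV, hL⟩ := hf.to_localInverse.exists_lipschitzOnWith
  have hmem : ∀ᶠ y in 𝓝 (f a), hf.localInverse f f' a y ∈ U := by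
    refine hf.localInverse_continuousAt.eventually ?_
    rwa [hf.localInverse_apply_image]
  have hW := hmem.and hf.eventually_right_inverse
  exact ⟨V ∩ _, inter_mem hV hW, _, ⟨L, hL.mono Set.inter_subset_left⟩, fun y hy => hy.2⟩

theorem isUnit_of_norm_inverse_mul_norm_sub_lt_one {R : Type*} [NormedRing R]
    [HasSummableGeomSeries R] {a b : R} (ha : IsUnit a) (h : ‖Ring.inverse a‖ * ‖a - b‖ < 1) :
    IsUnit b := by
  have hb : b = a * (1 - Ring.inverse a * (a - b)) := by
    rw [mul_sub, mul_one, Ring.mul_inverse_cancel_left _ _ ha, sub_sub_cancel]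
  rw [hb]
  exact ha.mul (isUnit_one_sub_of_norm_lt_one ((norm_mul_le _ _).trans_lt h))

section LinearSystems

variable {𝕜 ι : Type*} [RCLike 𝕜] [Fintype ι] [DecidableEq ι] {A B : Matrix ι ι 𝕜} {M q : ℝ}

theorem eq_inv_mulVec_of_mulVec_eq (hA : IsUnit A) {v w : ι → 𝕜} (h : A *ᵥ v = w) :
    v = A⁻¹ *ᵥ w := by
  have := hA.invertible
  exact (Matrix.inv_mulVec_eq_vec h.symm).symm

theorem norm_mulVec_le_of_norm_le (hA : ‖A‖ ≤ M) (v : EuclideanSpace 𝕜 ι) :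
    ‖WithLp.toLp 2 (A *ᵥ v.ofLp)‖ ≤ M * ‖v‖ :=
  (Matrix.l2_opNorm_mulVec A v).trans (by gcongr)

theorem norm_sub_le_of_mulVec_eq_mulVec (hA : IsUnit A) (hM : ‖A⁻¹‖ ≤ M) (hq : ‖A - B‖ ≤ q)
    (hMq : M * q < 1) {v w : EuclideanSpace 𝕜 ι} (h : A *ᵥ v.ofLp = B *ᵥ w.ofLp) :
    ‖v - w‖ ≤ M * q / (1 - M * q) * ‖v‖ := by
  have hM0 : 0 ≤ M := (norm_nonneg _).trans hM
  have hq0 : 0 ≤ q := (norm_nonneg _).trans hq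
  have hsub : A *ᵥ (w - v).ofLp = (A - B) *ᵥ w.ofLp := by
    rw [WithLp.ofLp_sub, Matrix.mulVec_sub, Matrix.sub_mulVec, h]
  have hsub_le : ‖w - v‖ ≤ M * q * ‖w‖ := calc
    ‖w - v‖ = ‖WithLp.toLp 2 (A⁻¹ *ᵥ ((A - B) *ᵥ w.ofLp))‖ := by
      rw [← eq_inv_mulVec_of_mulVec_eq hA hsub]
    _ ≤ M * ‖WithLp.toLp 2 ((A - B) *ᵥ w.ofLp)‖ :=
      norm_mulVec_le_of_norm_le hM (WithLp.toLp 2 ((A - B) *ᵥ w.ofLp))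
    _ ≤ M * q * ‖w‖ := by
      rw [mul_assoc]
      gcongr
      exact norm_mulVec_le_of_norm_le hq w
  have hw : M * q * ‖w‖ ≤ M * q * (‖v‖ + ‖w - v‖) := by
    gcongr
    exact norm_le_norm_add_norm_sub' w v
  rw [norm_sub_rev, div_mul_eq_mul_div, le_div_iff₀ (sub_pos.2 hMq)]
  linarith

end LinearSystems

variable {n m : ℕ}

theorem PDVec.norm_sq_eq (v : PDVec n m) :
    ‖v‖ ^ 2 = ∑ j, primal v j ^ 2 + (∑ i, mult v i ^ 2 + ∑ i, slack v i ^ 2) := by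
  rw [EuclideanSpace.real_norm_sq_eq, Fintype.sum_sum_type, Fintype.sum_sum_type]
  rfl

theorem pairSize_nonneg (v : PDVec n m) (i : Fin m) : 0 ≤ pairSize v i :=
  Real.sqrt_nonneg _

theorem sum_pairSize_sq_le (v : PDVec n m) : ∑ i, pairSize v i ^ 2 ≤ ‖v‖ ^ 2 := by
  have hsq (i : Fin m) : pairSize v i ^ 2 = mult v i ^ 2 + slack v i ^ 2 :=
    Real.sq_sqrt (by positivity)
  simp only [hsq, Finset.sum_add_distrib, PDVec.norm_sq_eq]
  exact le_add_of_nonneg_left (by positivity)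

theorem pairSize_le_norm (v : PDVec n m) (i : Fin m) : pairSize v i ≤ ‖v‖ := by
  refine (sq_le_sq₀ (pairSize_nonneg v i) (norm_nonneg v)).1 (le_trans ?_ (sum_pairSize_sq_le v))
  exact Finset.single_le_sum (f := fun i => pairSize v i ^ 2) (fun _ _ => sq_nonneg _)
    (Finset.mem_univ i)

theorem pairSize_le_orderedPairSize {d : PDVec n m} {r : ℕ} (hr : r < m) {T : Finset (Fin m)}
    (hT : IsLargestSet d r T) {j : Fin m} (hj : j ∉ T) :
    pairSize d j ≤ orderedPairSize d ⟨r, hr⟩ := by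
  obtain ⟨rfl, hlargest⟩ := hT
  exact neg_le_neg_iff.1 <| apply_sort_card_le_of_notMem (f := fun i => -pairSize d i)
    (fun i hi j hj => neg_le_neg (hlargest i hi j hj)) hr hj

/-- The matrix whose complementarity rows are `[0, diag s, diag l]` and whose other rows vanish.
With `l = mult d` and `s = slack d` it is the second derivative of `F_μ` in the direction `d`. -/
def complMatrix (n : ℕ) {m : ℕ} (l s : Fin m → ℝ) : Matrix (Idx n m) (Idx n m) ℝ :=
  Matrix.fromBlocks 0 0 0 (Matrix.fromBlocks 0 0 (Matrix.diagonal s) (Matrix.diagonal l))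

theorem PDVec.ofLp_eq_elim (v : PDVec n m) :
    v.ofLp = Sum.elim (primal v) (Sum.elim (mult v) (slack v)) := by
  funext k
  rcases k with j | i | i <;> rfl

theorem complMatrix_mulVec (l s : Fin m → ℝ) (v : PDVec n m) :
    complMatrix n l s *ᵥ v.ofLp =
      Sum.elim (0 : Fin n → ℝ)
        (Sum.elim (0 : Fin m → ℝ) fun i => s i * mult v i + l i * slack v i) := by
  rw [v.ofLp_eq_elim, complMatrix]
  funext k
  rcases k with j | i | i <;>
    simp [Matrix.fromBlocks_mulVec, Matrix.mulVec_diagonal, Function.comp_def]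

theorem norm_complMatrix_le {l s : Fin m → ℝ} {q : ℝ} (hq : 0 ≤ q)
    (h : ∀ i, √(l i ^ 2 + s i ^ 2) ≤ q) : ‖complMatrix n l s‖ ≤ q := by
  rw [Matrix.l2_opNorm_def]
  refine ContinuousLinearMap.opNorm_le_bound _ hq fun v => ?_
  change ‖(WithLp.toLp 2 (complMatrix n l s *ᵥ v.ofLp) : PDVec n m)‖ ≤ q * ‖v‖
  have hrow (i : Fin m) : (s i * mult v i + l i * slack v i) ^ 2 ≤ q ^ 2 * pairSize v i ^ 2 := calc
    _ ≤ (l i ^ 2 + s i ^ 2) * (mult v i ^ 2 + slack v i ^ 2) := by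
      linarith [sq_nonneg (s i * slack v i - l i * mult v i)]
    _ ≤ q ^ 2 * pairSize v i ^ 2 := by
      rw [pairSize, Real.sq_sqrt (by positivity)]
      gcongr
      exact (Real.sqrt_le_left hq).1 (h i)
  refine (sq_le_sq₀ (norm_nonneg _) (by positivity)).1 ?_
  calc ‖(WithLp.toLp 2 (complMatrix n l s *ᵥ v.ofLp) : PDVec n m)‖ ^ 2
      = ∑ i, (s i * mult v i + l i * slack v i) ^ 2 := by
        rw [PDVec.norm_sq_eq, complMatrix_mulVec]
        simp [primal, mult, slack]
    _ ≤ ∑ i, q ^ 2 * pairSize v i ^ 2 := Finset.sum_le_sum fun i _ => hrow i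
    _ ≤ q ^ 2 * ‖v‖ ^ 2 := by
        rw [← Finset.mul_sum]
        gcongr
        exact sum_pairSize_sq_le v
    _ = (q * ‖v‖) ^ 2 := (mul_pow q ‖v‖ 2).symm

theorem updateMatrix_eq_complMatrix (d : PDVec n m) (T : Finset (Fin m)) :
    updateMatrix d T = complMatrix n (T.piecewise (mult d) 0) (T.piecewise (slack d) 0) := by
  ext k k'
  rw [updateMatrix, Matrix.sum_apply, complMatrix]
  rcases k with j | i | i
  · rcases k' with j' | i' | i' <;> simp [Matrix.vecMulVec_apply]
  · rcases k' with j' | i' | i' <;> simp [Matrix.vecMulVec_apply]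
  · rcases k' with j' | i' | i'
    · simp [Matrix.vecMulVec_apply]
    · rcases eq_or_ne i i' with rfl | hne <;>
        simp [Matrix.vecMulVec_apply, Pi.single_apply, Finset.piecewise, *]
    · rcases eq_or_ne i i' with rfl | hne <;>
        simp [Matrix.vecMulVec_apply, Pi.single_apply, Finset.piecewise, *]

theorem complMatrix_sub (l s l' s' : Fin m → ℝ) :
    complMatrix n l s - complMatrix n l' s' = complMatrix n (l - l') (s - s') := by
  rw [sub_eq_iff_eq_add]
  simp [complMatrix, Matrix.fromBlocks_add]

theorem QP.jac_add (P : QP n m) (z d : PDVec n m) :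
    P.jac (z + d) = P.jac z + complMatrix n (mult d) (slack d) := by
  have hmult : mult (z + d) = mult z + mult d := rfl
  have hslack : slack (z + d) = slack z + slack d := rfl
  simp [QP.jac, complMatrix, Matrix.fromBlocks_add, hmult, hslack, Pi.add_def]

theorem QP.jac_add_sub_modJac (P : QP n m) (z d : PDVec n m) (T : Finset (Fin m)) :
    P.jac (z + d) - P.modJac z d T =
      complMatrix n (T.piecewise 0 (mult d)) (T.piecewise 0 (slack d)) := by
  have hcompl (u : Fin m → ℝ) : u - T.piecewise u 0 = T.piecewise 0 u := by
    funext i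
    by_cases hi : i ∈ T <;> simp [hi]
  rw [P.jac_add, QP.modJac, add_sub_add_left_eq_sub, updateMatrix_eq_complMatrix,
    ← hcompl (mult d), ← hcompl (slack d)]
  exact complMatrix_sub _ _ _ _

theorem QP.norm_jac_add_sub_modJac_le (P : QP n m) (z : PDVec n m) {d : PDVec n m} {r : ℕ}
    (hr : r < m) {T : Finset (Fin m)} (hT : IsLargestSet d r T) :
    ‖P.jac (z + d) - P.modJac z d T‖ ≤ orderedPairSize d ⟨r, hr⟩ := by
  have hq : 0 ≤ orderedPairSize d ⟨r, hr⟩ := pairSize_nonneg d _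
  rw [P.jac_add_sub_modJac]
  refine norm_complMatrix_le hq fun i => ?_
  by_cases hi : i ∈ T
  · simpa [hi] using hq
  · simpa [hi, pairSize] using pairSize_le_orderedPairSize hr hT hi

theorem QP.jac_mulVec (P : QP n m) (z v : PDVec n m) :
    P.jac z *ᵥ v.ofLp = Sum.elim (P.H *ᵥ primal v - P.Aᵀ *ᵥ mult v)
      (Sum.elim (P.A *ᵥ primal v - slack v)
        (fun i => slack z i * mult v i + mult z i * slack v i)) := by
  rw [v.ofLp_eq_elim, QP.jac]
  funext k
  rcases k with j | i | i <;>
    simp [Matrix.fromBlocks_mulVec, Matrix.mulVec_diagonal, Matrix.neg_mulVec,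
      Matrix.fromCols_mulVec, Matrix.fromRows_mulVec, sub_eq_add_neg, Function.comp_def]

theorem QP.residual_add (P : QP n m) (μ : ℝ) (z d : PDVec n m) :
    P.residual μ (z + d) = P.residual μ z + WithLp.toLp 2 (P.jac z *ᵥ d.ofLp) +
      (1 / 2 : ℝ) • WithLp.toLp 2 (complMatrix n (mult d) (slack d) *ᵥ d.ofLp) := by
  have hprimal : primal (z + d) = primal z + primal d := rfl
  have hmult : mult (z + d) = mult z + mult d := rfl
  have hslack : slack (z + d) = slack z + slack d := rfl
  rw [P.jac_mulVec, complMatrix_mulVec]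
  ext k
  rcases k with j | i | i <;>
    simp only [QP.residual, hprimal, hmult, hslack, Matrix.mulVec_add, Sum.elim_inl, Sum.elim_inr,
      PiLp.add_apply, PiLp.smul_apply, Pi.add_apply, Pi.sub_apply, Pi.zero_apply, smul_eq_mul] <;>
    ring

theorem norm_half_smul_complMatrix_mulVec_le (d : PDVec n m) :
    ‖(1 / 2 : ℝ) • (WithLp.toLp 2 (complMatrix n (mult d) (slack d) *ᵥ d.ofLp) : PDVec n m)‖ ≤
      ‖d‖ ^ 2 / 2 := by
  have h := norm_mulVec_le_of_norm_le (norm_complMatrix_le (norm_nonneg d) (pairSize_le_norm d)) d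
  rw [norm_smul, Real.norm_of_nonneg (by norm_num)]
  linarith

theorem QP.residual_eq_add_smul (P : QP n m) (μ ν : ℝ) (z : PDVec n m) :
    P.residual μ z = P.residual ν z + (μ - ν) • residualDeriv n m := by
  ext k
  rcases k with j | i | i <;> simp [QP.residual, residualDeriv]

theorem QP.continuous_jac (P : QP n m) : Continuous P.jac := by
  have hmult : Continuous (mult : PDVec n m → Fin m → ℝ) := by unfold mult; fun_prop
  have hslack : Continuous (slack : PDVec n m → Fin m → ℝ) := by unfold slack; fun_prop
  exact continuous_const.matrix_fromBlocks continuous_const continuous_const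
    (continuous_const.matrix_fromBlocks continuous_const hslack.matrix_diagonal
      hmult.matrix_diagonal)

theorem QP.hasFDerivAt_residual (P : QP n m) (μ : ℝ) (z : PDVec n m) :
    HasFDerivAt (P.residual μ) (Matrix.toEuclideanCLM (𝕜 := ℝ) (P.jac z)) z := by
  rw [hasFDerivAt_iff_isLittleO_nhds_zero]
  refine Asymptotics.IsBigO.trans_isLittleO (g := fun d : PDVec n m => ‖d‖ ^ 2) ?_
    (Asymptotics.isLittleO_norm_pow_id one_lt_two)
  refine Asymptotics.IsBigO.of_bound (1 / 2) (Eventually.of_forall fun d => ?_)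
  have hquad : P.residual μ (z + d) - P.residual μ z - Matrix.toEuclideanCLM (𝕜 := ℝ) (P.jac z) d =
      (1 / 2 : ℝ) • WithLp.toLp 2 (complMatrix n (mult d) (slack d) *ᵥ d.ofLp) := by
    rw [P.residual_add, show Matrix.toEuclideanCLM (𝕜 := ℝ) (P.jac z) d =
      WithLp.toLp 2 (P.jac z *ᵥ d.ofLp) from rfl]
    abel
  rw [hquad, norm_pow, norm_norm, one_div_mul_eq_div]
  exact norm_half_smul_complMatrix_mulVec_le d

theorem QP.hasStrictFDerivAt_residual (P : QP n m) (μ : ℝ) (z : PDVec n m) :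
    HasStrictFDerivAt (P.residual μ) (Matrix.toEuclideanCLM (𝕜 := ℝ) (P.jac z)) z := by
  have hcont : Continuous fun y => Matrix.toEuclideanCLM (𝕜 := ℝ) (P.jac y) :=
    (LinearMap.continuous_of_finiteDimensional
      (Matrix.toEuclideanCLM (𝕜 := ℝ) (n := Idx n m)).toAlgEquiv.toLinearMap).comp P.continuous_jac
  exact hasStrictFDerivAt_of_hasFDerivAt_of_continuousAt
    (Eventually.of_forall (P.hasFDerivAt_residual μ)) hcont.continuousAt

section StrictMin

variable {P : QP n m} {zs : PDVec n m}

theorem QP.IsStrictMin.residual_zero (hzs : P.IsStrictMin zs) : P.residual 0 zs = 0 := by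
  ext k
  rcases k with j | i | i
  · simpa [QP.residual] using congrFun hzs.stationarity j
  · simpa [QP.residual] using congrFun hzs.feasibility i
  · simpa [QP.residual, mul_comm] using hzs.complementarity i

theorem QP.IsStrictMin.slack_eq_zero_of_active (hzs : P.IsStrictMin zs) {v : PDVec n m} {i : Fin m}
    (hv : slack zs i * mult v i + mult zs i * slack v i = 0) (hi : slack zs i = 0) :
    slack v i = 0 := by
  have hmult : 0 < mult zs i := by simpa [hi] using hzs.strict i
  simpa [hi, hmult.ne'] using hv

theorem QP.IsStrictMin.mult_eq_zero_of_inactive (hzs : P.IsStrictMin zs) {v : PDVec n m} {i : Fin m}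
    (hv : slack zs i * mult v i + mult zs i * slack v i = 0) (hi : slack zs i ≠ 0) :
    mult v i = 0 := by
  have hmult : mult zs i = 0 := (mul_eq_zero.1 (hzs.complementarity i)).resolve_left hi
  simpa [hi, hmult] using hv

theorem QP.IsStrictMin.primal_eq_zero (hzs : P.IsStrictMin zs) {v : PDVec n m}
    (hstat : P.H *ᵥ primal v = P.Aᵀ *ᵥ mult v) (hfeas : P.A *ᵥ primal v = slack v)
    (hcompl : ∀ i, slack zs i * mult v i + mult zs i * slack v i = 0) : primal v = 0 := by
  by_contra hne
  have hpos : 0 < primal v ⬝ᵥ P.H *ᵥ primal v := hzs.posDef _ hne fun i hi _ => by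
    rw [hfeas, hzs.slack_eq_zero_of_active (hcompl i) hi]
  refine hpos.ne' ?_
  calc primal v ⬝ᵥ P.H *ᵥ primal v = slack v ⬝ᵥ mult v := by
        rw [hstat, Matrix.dotProduct_mulVec, Matrix.vecMul_transpose, hfeas]
    _ = 0 := Finset.sum_eq_zero fun i _ => by
        by_cases hi : slack zs i = 0
        · rw [hzs.slack_eq_zero_of_active (hcompl i) hi, zero_mul]
        · rw [hzs.mult_eq_zero_of_inactive (hcompl i) hi, mul_zero]

theorem QP.LICQ.eq_zero_of_transpose_mulVec_eq_zero (h : P.LICQ zs) {y : Fin m → ℝ}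
    (hy : ∀ i, slack zs i ≠ 0 → y i = 0) (hAy : P.Aᵀ *ᵥ y = 0) : y = 0 := by
  have hsum : ∑ i : {i : Fin m // slack zs i = 0}, y i • P.A (i : Fin m) = 0 := by
    rw [Matrix.mulVec_transpose, Matrix.vecMul_eq_sum] at hAy
    rw [← hAy, ← Finset.sum_subtype (Finset.univ.filter fun i => slack zs i = 0) (by simp)
      (fun i => y i • P.A i)]
    refine Finset.sum_filter_of_ne fun i _ hne => ?_
    by_contra hi
    exact hne (by rw [hy i hi, zero_smul])
  funext i
  by_cases hi : slack zs i = 0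
  · exact Fintype.linearIndependent_iff.1 h (fun i => y i) hsum ⟨i, hi⟩
  · exact hy i hi

theorem QP.IsStrictMin.isUnit_jac (hzs : P.IsStrictMin zs) (hli : P.LICQ zs) :
    IsUnit (P.jac zs) := by
  rw [← Matrix.mulVec_injective_iff_isUnit]
  refine (injective_iff_map_eq_zero (P.jac zs).mulVecLin).2 fun v' hv => ?_
  obtain ⟨v, rfl⟩ : ∃ v : PDVec n m, v.ofLp = v' := WithLp.ofLp_surjective 2 v'
  rw [Matrix.mulVecLin_apply, P.jac_mulVec] at hv
  have hstat : P.H *ᵥ primal v = P.Aᵀ *ᵥ mult v :=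
    sub_eq_zero.1 (funext fun j => congrFun hv (ix j))
  have hfeas : P.A *ᵥ primal v = slack v :=
    sub_eq_zero.1 (funext fun i => congrFun hv (il i))
  have hcompl (i : Fin m) : slack zs i * mult v i + mult zs i * slack v i = 0 := congrFun hv (is i)
  have hprimal : primal v = 0 := hzs.primal_eq_zero hstat hfeas hcompl
  have hslack : slack v = 0 := by rw [← hfeas, hprimal, Matrix.mulVec_zero]
  have hmult : mult v = 0 := hli.eq_zero_of_transpose_mulVec_eq_zero
    (fun i => hzs.mult_eq_zero_of_inactive (hcompl i))
    (by rw [← hstat, hprimal, Matrix.mulVec_zero])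
  rw [v.ofLp_eq_elim, hprimal, hmult, hslack]
  simp only [Sum.elim_zero_zero]

theorem QP.exists_isJacNhd_of_isUnit_jac (h : IsUnit (P.jac zs)) :
    ∃ δ M : ℝ, P.IsJacNhd zs δ M := by
  have hinv : ContinuousAt (fun z => ‖(P.jac z)⁻¹‖) zs := by
    simp only [Matrix.nonsing_inv_eq_ringInverse]
    have hjac : ContinuousAt Ring.inverse (P.jac zs) := NormedRing.inverse_continuousAt h.unit
    exact (hjac.comp P.continuous_jac.continuousAt).norm
  have hunit : ∀ᶠ z in 𝓝 zs, IsUnit (P.jac z) :=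
    P.continuous_jac.continuousAt.eventually (Units.isOpen.mem_nhds h)
  have hbound : ∀ᶠ z in 𝓝 zs, ‖(P.jac z)⁻¹‖ < ‖(P.jac zs)⁻¹‖ + 1 :=
    hinv.eventually_lt_const (lt_add_one _)
  obtain ⟨δ, hδ, hball⟩ := Metric.eventually_nhds_iff_ball.1 (hunit.and hbound)
  exact ⟨δ, ‖(P.jac zs)⁻¹‖ + 1, hδ, by positivity, fun z hz => (hball z hz).imp_right le_of_lt⟩

theorem QP.exists_isTrajectory (hres : P.residual 0 zs = 0) (hu : IsUnit (P.jac zs)) {δ : ℝ}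
    (hδ : 0 < δ) : ∃ (μhat : ℝ) (zμ : ℝ → PDVec n m), P.IsTrajectory zs δ μhat zμ := by
  obtain ⟨u, hu⟩ := hu.map (Matrix.toEuclideanCLM (𝕜 := ℝ) (n := Idx n m))
  have hderiv : HasStrictFDerivAt (P.residual 0)
      (ContinuousLinearEquiv.unitsEquiv ℝ _ u : PDVec n m →L[ℝ] PDVec n m) zs := by
    convert P.hasStrictFDerivAt_residual 0 zs
    exact hu
  obtain ⟨V, hV, g, ⟨L, hL⟩, hg⟩ :=
    exists_lipschitzOnWith_rightInverse hderiv (Metric.ball_mem_nhds zs hδ)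
  rw [hres] at hV
  let line : ℝ →L[ℝ] PDVec n m := -ContinuousLinearMap.toSpanSingleton ℝ (residualDeriv n m)
  have hline : ∀ᶠ μ in 𝓝[>] 0, line μ ∈ V :=
    (line.continuous.tendsto' 0 0 (map_zero line)).eventually hV |>.filter_mono nhdsWithin_le_nhds
  obtain ⟨μhat, hμhat, hmem⟩ := exists_mem_Ioc_forall_mem_Ioc one_pos hline
  refine ⟨μhat, g ∘ line, hμhat.1, ⟨_, hL.comp line.lipschitz.lipschitzOnWith hmem⟩,
    fun μ hμ => ⟨(hg _ (hmem μ hμ)).1, ?_⟩⟩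
  rw [P.residual_eq_add_smul μ 0, Function.comp_apply, (hg _ (hmem μ hμ)).2]
  simp [line]

end StrictMin

section Estimates

variable {P : QP n m} {zs : PDVec n m} {δ M : ℝ}

theorem QP.trajConst_nonneg (P : QP n m) (zs : PDVec n m) (δ : ℝ) : 0 ≤ P.trajConst zs δ :=
  Real.iSup_nonneg fun _ => norm_nonneg _

theorem QP.IsJacNhd.norm_inv_mulVec_residualDeriv_le (h : P.IsJacNhd zs δ M) {z : PDVec n m}
    (hz : z ∈ Metric.ball zs δ) :
    ‖WithLp.toLp 2 ((P.jac z)⁻¹ *ᵥ (residualDeriv n m).ofLp)‖ ≤ P.trajConst zs δ := by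
  refine le_ciSup (f := fun z : Metric.ball zs δ =>
    ‖WithLp.toLp 2 ((P.jac (z : PDVec n m))⁻¹ *ᵥ (residualDeriv n m).ofLp)‖) ?_ ⟨z, hz⟩
  refine ⟨M * ‖residualDeriv n m‖, ?_⟩
  rintro _ ⟨y, rfl⟩
  exact norm_mulVec_le_of_norm_le (h.2.2 y y.2).2 _

theorem QP.IsJacNhd.norm_newtonStep_le (h : P.IsJacNhd zs δ M) {μ ν : ℝ} {z d : PDVec n m}
    (hz : z ∈ Metric.ball zs δ) (hd : P.IsNewtonStep ν z d) :
    ‖d‖ ≤ |ν - μ| * P.trajConst zs δ + M * ‖P.residual μ z‖ := by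
  obtain ⟨hunit, hM⟩ := h.2.2 z hz
  have hsplit : d = -((ν - μ) • WithLp.toLp 2 ((P.jac z)⁻¹ *ᵥ (residualDeriv n m).ofLp) +
      WithLp.toLp 2 ((P.jac z)⁻¹ *ᵥ (P.residual μ z).ofLp)) := by
    apply WithLp.ofLp_injective 2
    rw [eq_inv_mulVec_of_mulVec_eq hunit hd, P.residual_eq_add_smul ν μ, add_comm]
    simp only [WithLp.ofLp_add, WithLp.ofLp_smul, WithLp.ofLp_neg, Matrix.mulVec_neg,
      Matrix.mulVec_add, Matrix.mulVec_smul]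
  rw [hsplit, norm_neg]
  refine norm_add_le_of_le ?_ (norm_mulVec_le_of_norm_le hM _)
  rw [norm_smul, Real.norm_eq_abs]
  gcongr
  exact h.norm_inv_mulVec_residualDeriv_le hz

theorem QP.IsNewtonStep.norm_residual_add_le {μ : ℝ} {z d : PDVec n m}
    (h : P.IsNewtonStep μ z d) : ‖P.residual μ (z + d)‖ ≤ ‖d‖ ^ 2 / 2 := by
  have hlin : P.residual μ z + WithLp.toLp 2 (P.jac z *ᵥ d.ofLp) = 0 := by
    rw [show P.jac z *ᵥ d.ofLp = _ from h, ← WithLp.ofLp_neg, WithLp.toLp_ofLp, add_neg_cancel]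
  rw [P.residual_add, hlin, zero_add]
  exact norm_half_smul_complMatrix_mulVec_le d

/-- A constant `C'` such that the first Newton step has norm at most `C' μ` whenever
`‖F_μ(z)‖ ≤ C μ`. -/
noncomputable def QP.stepConst (P : QP n m) (zs : PDVec n m) (δ M C : ℝ) : ℝ :=
  P.trajConst zs δ + M * C

/-- The constant of the `O(μ ^ 3)` term of the error bound: `M / 2 * (C' μ) ^ 2` bounds
`‖F'(z⁺)⁻¹ F_{μ⁺}(z⁺)‖`, where `C'` is `QP.stepConst`. -/
noncomputable def QP.cubicConst (P : QP n m) (zs : PDVec n m) (δ M C : ℝ) : ℝ :=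
  M / 2 * P.stepConst zs δ M C ^ 2

theorem QP.stepConst_pos (P : QP n m) (zs : PDVec n m) (δ : ℝ) {C : ℝ} (hM : 0 < M) (hC : 0 < C) :
    0 < P.stepConst zs δ M C :=
  add_pos_of_nonneg_of_pos (P.trajConst_nonneg zs δ) (mul_pos hM hC)

theorem QP.cubicConst_pos (P : QP n m) (zs : PDVec n m) (δ : ℝ) {C : ℝ} (hM : 0 < M) (hC : 0 < C) :
    0 < P.cubicConst zs δ M C :=
  mul_pos (half_pos hM) (pow_pos (P.stepConst_pos zs δ hM hC) 2)

variable {C μ σ σ' : ℝ} {r : ℕ} {z dz dzN dzM : PDVec n m} {T : Finset (Fin m)}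

theorem QP.IsFirstStep.norm_le (hs : P.IsFirstStep zs δ C r μ σ z dz T) (hJ : P.IsJacNhd zs δ M)
    (hμ : 0 ≤ μ) (hσ : σ ∈ Set.Icc (0 : ℝ) 1) : ‖dz‖ ≤ P.stepConst zs δ M C * μ := by
  have hC3 := P.trajConst_nonneg zs δ
  have hM := hJ.2.1
  have hdiff : |σ * μ - μ| ≤ μ := by
    rw [← sub_one_mul, abs_mul, abs_of_nonneg hμ]
    exact mul_le_of_le_one_left hμ (abs_le.2 ⟨by linarith [hσ.1], by linarith [hσ.2]⟩)
  calc ‖dz‖ ≤ |σ * μ - μ| * P.trajConst zs δ + M * ‖P.residual μ z‖ :=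
        hJ.norm_newtonStep_le hs.mem_ball hs.newton
    _ ≤ μ * P.trajConst zs δ + M * (C * μ) := by
        gcongr
        exact hs.residual_le
    _ = P.stepConst zs δ M C * μ := by rw [QP.stepConst]; ring

theorem QP.IsFirstStep.orderedPairSize_le (hs : P.IsFirstStep zs δ C r μ σ z dz T)
    (hJ : P.IsJacNhd zs δ M) (hμ : 0 ≤ μ) (hσ : σ ∈ Set.Icc (0 : ℝ) 1) (k : Fin m) :
    orderedPairSize dz k ≤ P.stepConst zs δ M C * μ :=
  (pairSize_le_norm dz _).trans (hs.norm_le hJ hμ hσ)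

theorem QP.IsFirstStep.norm_nextNewtonStep_le (hs : P.IsFirstStep zs δ C r μ σ z dz T)
    (hJ : P.IsJacNhd zs δ M) (hμ : 0 ≤ μ) (hσ : σ ∈ Set.Icc (0 : ℝ) 1) (hσ' : σ' ≤ 1)
    (hN : P.IsNewtonStep (σ' * (σ * μ)) (z + dz) dzN) :
    ‖dzN‖ ≤ P.trajConst zs δ * (1 - σ') * σ * μ + P.cubicConst zs δ M C * μ ^ 2 := by
  have hM := hJ.2.1
  have hdiff : |σ' * (σ * μ) - σ * μ| = (1 - σ') * (σ * μ) := by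
    rw [abs_sub_comm, ← one_sub_mul,
      abs_of_nonneg (mul_nonneg (sub_nonneg.2 hσ') (mul_nonneg hσ.1 hμ))]
  calc ‖dzN‖ ≤ (1 - σ') * (σ * μ) * P.trajConst zs δ + M * ‖P.residual (σ * μ) (z + dz)‖ := by
        rw [← hdiff]
        exact hJ.norm_newtonStep_le hs.next_mem_ball hN
    _ ≤ (1 - σ') * (σ * μ) * P.trajConst zs δ + M * ((P.stepConst zs δ M C * μ) ^ 2 / 2) := by
        gcongr
        refine hs.newton.norm_residual_add_le.trans ?_
        gcongr
        exact hs.norm_le hJ hμ hσ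
    _ = _ := by rw [QP.cubicConst]; ring

theorem QP.IsFirstStep.isUnit_modJac {q : ℝ} (hs : P.IsFirstStep zs δ C r μ σ z dz T)
    (hJ : P.IsJacNhd zs δ M) (hr : r < m) (hq : orderedPairSize dz ⟨r, hr⟩ ≤ q)
    (hlt : M * q < 1) : IsUnit (P.modJac z dz T) := by
  obtain ⟨hunit, hinv⟩ := hJ.2.2 _ hs.next_mem_ball
  rw [Matrix.nonsing_inv_eq_ringInverse] at hinv
  refine isUnit_of_norm_inverse_mul_norm_sub_lt_one hunit (lt_of_le_of_lt ?_ hlt)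
  exact mul_le_mul hinv ((P.norm_jac_add_sub_modJac_le z hr hs.largest).trans hq) (norm_nonneg _)
    hJ.2.1.le

theorem QP.IsFirstStep.norm_newton_sub_modNewton_le {Cr : ℝ}
    (hs : P.IsFirstStep zs δ C r μ σ z dz T) (hJ : P.IsJacNhd zs δ M) (hr : r < m) (hμ : 0 ≤ μ)
    (hσ : σ ∈ Set.Icc (0 : ℝ) 1) (hσ' : σ' ≤ 1) (hq : orderedPairSize dz ⟨r, hr⟩ ≤ Cr * μ)
    (hlt : M * Cr * μ < 1) (hN : P.IsNewtonStep (σ' * (σ * μ)) (z + dz) dzN)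
    (hM : P.IsModNewtonStep (σ' * (σ * μ)) z dz T dzM) :
    ‖dzN - dzM‖ ≤ M * Cr / (1 - M * Cr * μ) *
      (P.trajConst zs δ * (1 - σ') * σ * μ ^ 2 + P.cubicConst zs δ M C * μ ^ 3) := by
  obtain ⟨hunit, hinv⟩ := hJ.2.2 _ hs.next_mem_ball
  have hMq : 0 ≤ M * Cr * μ := by
    rw [mul_assoc]
    exact mul_nonneg hJ.2.1.le ((pairSize_nonneg dz _).trans hq)
  have hpert : ‖P.jac (z + dz) - P.modJac z dz T‖ ≤ Cr * μ :=
    (P.norm_jac_add_sub_modJac_le z hr hs.largest).trans hq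
  calc ‖dzN - dzM‖ ≤ M * Cr * μ / (1 - M * Cr * μ) * ‖dzN‖ := by
        rw [mul_assoc] at hlt ⊢
        exact norm_sub_le_of_mulVec_eq_mulVec hunit hinv hpert hlt (hN.trans hM.symm)
    _ ≤ M * Cr * μ / (1 - M * Cr * μ) *
          (P.trajConst zs δ * (1 - σ') * σ * μ + P.cubicConst zs δ M C * μ ^ 2) :=
        mul_le_mul_of_nonneg_left (hs.norm_nextNewtonStep_le hJ hμ hσ hσ' hN)
          (div_nonneg hMq (sub_nonneg.2 hlt.le))
    _ = _ := by ring

theorem QP.IsFirstStep.norm_newton_sub_modNewton_le_of_le_half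
    (hs : P.IsFirstStep zs δ C r μ σ z dz T) (hJ : P.IsJacNhd zs δ M) (hr : r < m) (hC : 0 < C)
    (hμ : 0 ≤ μ) (hσ : σ ∈ Set.Icc (0 : ℝ) 1) (hσ' : σ' ≤ 1)
    (hhalf : M * P.stepConst zs δ M C * μ ≤ 1 / 2)
    (hN : P.IsNewtonStep (σ' * (σ * μ)) (z + dz) dzN)
    (hM : P.IsModNewtonStep (σ' * (σ * μ)) z dz T dzM) :
    ‖dzN - dzM‖ ≤ 2 * (M * P.stepConst zs δ M C) *
      (P.trajConst zs δ * (1 - σ') * σ * μ ^ 2 + P.cubicConst zs δ M C * μ ^ 3) := by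
  have hstep := mul_pos hJ.2.1 (P.stepConst_pos zs δ hJ.2.1 hC)
  have hcubic := P.cubicConst_pos zs δ hJ.2.1 hC
  have hC3 := P.trajConst_nonneg zs δ
  have hσ0 := hσ.1
  refine (hs.norm_newton_sub_modNewton_le hJ hr hμ hσ hσ' (hs.orderedPairSize_le hJ hμ hσ _)
    (by linarith) hN hM).trans (mul_le_mul_of_nonneg_right ?_ (by positivity))
  rw [div_le_iff₀ (by linarith)]
  nlinarith

/-- The constant of the `O(μ ^ 2)` and `O(μ ^ 3)` bounds of the error; the factor `2` bounds
`1 / (1 - M C' μ)` for small `μ`, where `C'` is `QP.stepConst`. -/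
noncomputable def QP.errorConst (P : QP n m) (zs : PDVec n m) (δ M C : ℝ) : ℝ :=
  2 * (M * P.stepConst zs δ M C) * (P.trajConst zs δ + P.cubicConst zs δ M C)

theorem QP.errorConst_pos (P : QP n m) (zs : PDVec n m) (δ : ℝ) {C : ℝ} (hM : 0 < M) (hC : 0 < C) :
    0 < P.errorConst zs δ M C := by
  have hstep := P.stepConst_pos zs δ hM hC
  have hcubic := P.cubicConst_pos zs δ hM hC
  have hC3 := P.trajConst_nonneg zs δ
  rw [QP.errorConst]
  positivity

theorem QP.IsFirstStep.norm_newton_sub_modNewton_le_sq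
    (hs : P.IsFirstStep zs δ C r μ σ z dz T) (hJ : P.IsJacNhd zs δ M) (hr : r < m) (hC : 0 < C)
    (hμ : μ ∈ Set.Icc (0 : ℝ) 1) (hσ : σ ∈ Set.Icc (0 : ℝ) 1) (hσ' : σ' ∈ Set.Icc (0 : ℝ) 1)
    (hhalf : M * P.stepConst zs δ M C * μ ≤ 1 / 2)
    (hN : P.IsNewtonStep (σ' * (σ * μ)) (z + dz) dzN)
    (hM : P.IsModNewtonStep (σ' * (σ * μ)) z dz T dzM) :
    ‖dzN - dzM‖ ≤ P.errorConst zs δ M C * μ ^ 2 := by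
  have hstep := mul_pos hJ.2.1 (P.stepConst_pos zs δ hJ.2.1 hC)
  have hcubic := P.cubicConst_pos zs δ hJ.2.1 hC
  have htraj : P.trajConst zs δ * (1 - σ') * σ ≤ P.trajConst zs δ := by
    rw [mul_assoc]
    exact mul_le_of_le_one_right (P.trajConst_nonneg zs δ)
      (mul_le_one₀ (by linarith [hσ'.1]) hσ.1 hσ.2)
  have hpow : μ ^ 3 ≤ μ ^ 2 := pow_le_pow_of_le_one hμ.1 hμ.2 (Nat.le_succ 2)
  calc ‖dzN - dzM‖ ≤ 2 * (M * P.stepConst zs δ M C) *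
          (P.trajConst zs δ * (1 - σ') * σ * μ ^ 2 + P.cubicConst zs δ M C * μ ^ 3) :=
        hs.norm_newton_sub_modNewton_le_of_le_half hJ hr hC hμ.1 hσ hσ'.2 hhalf hN hM
    _ ≤ 2 * (M * P.stepConst zs δ M C) *
          (P.trajConst zs δ * μ ^ 2 + P.cubicConst zs δ M C * μ ^ 2) := by
        gcongr
    _ = P.errorConst zs δ M C * μ ^ 2 := by rw [QP.errorConst]; ring

theorem QP.IsFirstStep.norm_newton_sub_modNewton_le_cube
    (hs : P.IsFirstStep zs δ C r μ σ z dz T) (hJ : P.IsJacNhd zs δ M) (hr : r < m) (hC : 0 < C)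
    (hμ : 0 ≤ μ) (hσ : σ ∈ Set.Icc (0 : ℝ) 1) (hhalf : M * P.stepConst zs δ M C * μ ≤ 1 / 2)
    (hN : P.IsNewtonStep (σ * μ) (z + dz) dzN)
    (hM : P.IsModNewtonStep (σ * μ) z dz T dzM) :
    ‖dzN - dzM‖ ≤ P.errorConst zs δ M C * μ ^ 3 := by
  have hstep := mul_pos hJ.2.1 (P.stepConst_pos zs δ hJ.2.1 hC)
  have htraj := P.trajConst_nonneg zs δ
  calc ‖dzN - dzM‖ ≤ 2 * (M * P.stepConst zs δ M C) *
          (P.trajConst zs δ * (1 - 1) * σ * μ ^ 2 + P.cubicConst zs δ M C * μ ^ 3) :=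
        hs.norm_newton_sub_modNewton_le_of_le_half hJ hr hC hμ hσ le_rfl hhalf
          (by rwa [one_mul]) (by rwa [one_mul])
    _ = 2 * (M * P.stepConst zs δ M C) * (P.cubicConst zs δ M C * μ ^ 3) := by ring
    _ ≤ 2 * (M * P.stepConst zs δ M C) *
          ((P.trajConst zs δ + P.cubicConst zs δ M C) * μ ^ 3) := by
        gcongr
        exact le_add_of_nonneg_left htraj
    _ = P.errorConst zs δ M C * μ ^ 3 := by rw [QP.errorConst]; ring

end Estimates

end QPBarrier

theorem mainTheorem2 {n m : ℕ} (P : QPBarrier.QP n m) (zs : QPBarrier.PDVec n m)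
    (hzs : P.IsStrictMin zs) :
    (P.LICQ zs → ∃ δ M : ℝ, P.IsJacNhd zs δ M) ∧
    ∀ δ M : ℝ, P.IsJacNhd zs δ M →
      (∃ (μhat : ℝ) (zμ : ℝ → QPBarrier.PDVec n m), P.IsTrajectory zs δ μhat zμ) ∧
      ∀ (μhat : ℝ) (zμ : ℝ → QPBarrier.PDVec n m), P.IsTrajectory zs δ μhat zμ →
      ∀ (r : ℕ) (hr : r < m) (C : ℝ), 0 < C →
        -- a constant `Cr` that bounds the `(r+1)`-st largest pair exists
        (∃ Cr : ℝ, 0 < Cr ∧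
          ∀ μ ∈ Set.Ioc 0 μhat, ∀ σ ∈ Set.Ioo (0 : ℝ) 1,
          ∀ (z dz : QPBarrier.PDVec n m) (T : Finset (Fin m)),
            P.IsFirstStep zs δ C r μ σ z dz T →
            QPBarrier.orderedPairSize dz ⟨r, hr⟩ ≤ Cr * μ) ∧
        -- the error bound; `K` is the constant of the `O(μ ^ 3)` term
        (∃ K : ℝ, 0 < K ∧ ∀ Cr : ℝ, 0 < Cr →
          ∃ μbar ∈ Set.Ioc 0 μhat,
          ∀ μ ∈ Set.Ioc 0 μbar, ∀ σ ∈ Set.Ioo (0 : ℝ) 1, ∀ σ' ∈ Set.Ioc (0 : ℝ) 1,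
          ∀ (z dz : QPBarrier.PDVec n m) (T : Finset (Fin m)),
            P.IsFirstStep zs δ C r μ σ z dz T →
            QPBarrier.orderedPairSize dz ⟨r, hr⟩ ≤ Cr * μ →
            M * Cr * μ < 1 ∧ IsUnit (P.modJac z dz T) ∧
            ∀ dzN dzM : QPBarrier.PDVec n m,
              P.IsNewtonStep (σ' * (σ * μ)) (z + dz) dzN →
              P.IsModNewtonStep (σ' * (σ * μ)) z dz T dzM →
              ‖dzN - dzM‖ ≤ M * Cr / (1 - M * Cr * μ) *
                (P.trajConst zs δ * (1 - σ') * σ * μ ^ 2 + K * μ ^ 3)) ∧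
        -- the error is `O(μ ^ 2)`, and `O(μ ^ 3)` if the barrier parameter is kept
        (∃ K : ℝ, 0 < K ∧ ∃ μbar ∈ Set.Ioc 0 μhat,
          ∀ μ ∈ Set.Ioc 0 μbar, ∀ σ ∈ Set.Ioo (0 : ℝ) 1, ∀ σ' ∈ Set.Ioc (0 : ℝ) 1,
          ∀ (z dz : QPBarrier.PDVec n m) (T : Finset (Fin m)),
            P.IsFirstStep zs δ C r μ σ z dz T →
            ∀ dzN dzM : QPBarrier.PDVec n m,
              P.IsNewtonStep (σ' * (σ * μ)) (z + dz) dzN →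
              P.IsModNewtonStep (σ' * (σ * μ)) z dz T dzM →
              ‖dzN - dzM‖ ≤ K * μ ^ 2 ∧ (σ' = 1 → ‖dzN - dzM‖ ≤ K * μ ^ 3)) := by
  refine ⟨fun hli => QPBarrier.QP.exists_isJacNhd_of_isUnit_jac (hzs.isUnit_jac hli),
    fun δ M hJ => ⟨QPBarrier.QP.exists_isTrajectory hzs.residual_zero
      (hJ.2.2 zs (Metric.mem_ball_self hJ.1)).1 hJ.1, fun μhat zμ htraj r hr C hC => ?_⟩⟩
  have hM : 0 < M := hJ.2.1
  refine ⟨⟨P.stepConst zs δ M C, P.stepConst_pos zs δ hM hC, fun μ hμ σ hσ z dz T hs =>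
      hs.orderedPairSize_le hJ hμ.1.le (Set.Ioo_subset_Icc_self hσ) _⟩,
    ⟨P.cubicConst zs δ M C, P.cubicConst_pos zs δ hM hC, fun Cr _ => ?_⟩,
    ⟨P.errorConst zs δ M C, P.errorConst_pos zs δ hM hC, ?_⟩⟩
  · obtain ⟨μbar, hμbar, hsmall⟩ := QPBarrier.exists_mem_Ioc_forall_mem_Ioc htraj.1
      (QPBarrier.eventually_nhdsGT_zero_mul_lt (M * Cr) one_pos)
    exact ⟨μbar, hμbar, fun μ hμ σ hσ σ' hσ' z dz T hs hq => ⟨hsmall μ hμ,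
      hs.isUnit_modJac hJ hr hq (by simpa only [mul_assoc] using hsmall μ hμ), fun dzN dzM =>
      hs.norm_newton_sub_modNewton_le hJ hr hμ.1.le (Set.Ioo_subset_Icc_self hσ) hσ'.2 hq
        (hsmall μ hμ)⟩⟩
  · obtain ⟨μbar, hμbar, hsmall⟩ := QPBarrier.exists_mem_Ioc_forall_mem_Ioc htraj.1
      ((QPBarrier.eventually_nhdsGT_zero_mul_lt (M * P.stepConst zs δ M C) one_half_pos).and
        (Ioc_mem_nhdsGT one_pos))
    refine ⟨μbar, hμbar, fun μ hμ σ hσ σ' hσ' z dz T hs dzN dzM hN hMod => ?_⟩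
    obtain ⟨hhalf, hμ1⟩ := hsmall μ hμ
    have hσ := Set.Ioo_subset_Icc_self hσ
    refine ⟨hs.norm_newton_sub_modNewton_le_sq hJ hr hC (Set.Ioc_subset_Icc_self hμ1) hσ
      (Set.Ioc_subset_Icc_self hσ') hhalf.le hN hMod, ?_⟩
    rintro rfl
    rw [one_mul] at hN hMod
    exact hs.norm_newton_sub_modNewton_le_cube hJ hr hC hμ1.1.le hσ hhalf.le hN hMod
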